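/- Consider a linear network with $N\ge 2$ hops and total length $L>0$, whose transmitters $A_1,\dots,A_N$ are placed in the plane $\mathbb{R}^2$ at $A_n=((n-1)L/N,\,0)$. All transmitters use power $p>0$, and the noise has unit variance. Let $\alpha>0$ be the path loss exponent, $R_t$ the rate of the transmitted codewords, $R_s<R_t$ the rate of the confidential information, and $\beta_e=2^{R_t-R_s}-1$. When an eavesdropper $e$ is at distance $|X_{ne}|$ from $A_n$ during hop $n$, its received SNR is $$\mathrm{SNR}_{ne}=\frac{p\,S_{ne}}{|X_{ne}|^{\alpha}+1},$$ where the fading gains $S_{ne}$ are independent over all hops and eavesdroppers, exponentially distributed with unit mean, and independent of the eavesdropper locations. The end-to-end secrecy outage probability is $$\mathcal{P}\Big(\max_{n=1,\dots,N}\ \max_{e}\ \mathrm{SNR}_{ne}>\beta_e\Big),$$ the inner maximum being over all eavesdroppers present in hop $n$. Let $\lambda_e>0$. Write $\mathcal{P}_{\mathrm{so}}$ for this probability when the eavesdropper locations in the $N$ hops form $N$ independent homogeneous Poisson point processes on $\mathbb{R}^2$, each of intensity $\lambda_e$, and $\mathcal{P}_{\mathrm{so\_fixed}}$ for this probability when the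 eavesdropper locations form a single homogeneous Poisson point process on $\mathbb{R}^2$ of intensity $\lambda_e$ that is the same in all $N$ hops (the fading gains still being independent from hop to hop). Then $$\mathcal{P}_{\mathrm{so\_fixed}}<\mathcal{P}_{\mathrm{so}}.$$ -/

import Mathlib

open MeasureTheory ProbabilityTheory

noncomputable section

/-- The plane `ℝ²` with its Euclidean distance and Lebesgue measure. -/
abbrev Plane : Type := EuclideanSpace ℝ (Fin 2)

/-- A random measure `Φ` on `E` is a Poisson process with (σ-finite) intensity measure `Λ`: the number of
points in a set `B` of finite intensity has the Poisson law with mean `Λ B`, and the numbers of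
points in finitely many pairwise disjoint sets are independent. -/
structure IsPoissonProcess {Ω E : Type*} [MeasurableSpace Ω] [MeasurableSpace E]
    (Φ : Ω → Measure E) (Λ : Measure E) (μ : Measure Ω) : Prop where
  measurable : Measurable Φ
  law : ∀ B : Set E, MeasurableSet B → Λ B < ⊤ →
    HasLaw (fun ω => Φ ω B)
      ((poissonMeasure (Λ B).toNNReal).map (fun k : ℕ => (k : ENNReal))) μ
  indep : ∀ (k : ℕ) (B : Fin k → Set E), (∀ j, MeasurableSet (B j)) →
    Pairwise (fun i j => Disjoint (B i) (B j)) →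
    iIndepFun (fun j ω => Φ ω (B j)) μ

/-- The counting measure `∑ᵢ δ_{Xᵢ}` of a random sequence of points. A homogeneous Poisson process
of positive intensity on the plane has almost surely infinitely many points, so that its points
can be listed as a sequence. -/
def pointProcess {Ω : Type*} (X : ℕ → Ω → Plane) (ω : Ω) : Measure Plane :=
  Measure.sum (fun i => Measure.dirac (X i ω))

/-- The random points `X 0, X 1, …` form a homogeneous PPP of intensity `lam` in the plane. -/
def IsHomogeneousPPP {Ω : Type*} [MeasurableSpace Ω] (X : ℕ → Ω → Plane) (lam : ℝ)
    (μ : Measure Ω) : Prop :=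
  (∀ i, Measurable (X i)) ∧
    IsPoissonProcess (pointProcess X) (ENNReal.ofReal lam • (volume : Measure Plane)) μ

/-- Rayleigh fading: the power gains `S n i` (hop `n`, eavesdropper `i`) are independent and
exponentially distributed with unit mean. -/
structure IsRayleighFading {Ω : Type*} [MeasurableSpace Ω] {N : ℕ}
    (S : Fin N → ℕ → Ω → ℝ) (μ : Measure Ω) : Prop where
  measurable : ∀ n i, Measurable (S n i)
  law : ∀ n i, HasLaw (S n i) (expMeasure 1) μ
  indep : iIndepFun (fun q : Fin N × ℕ => S q.1 q.2) μ

/-- Independent point processes: in each hop `n` the eavesdropper locations `X n 0, X n 1, …` form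
a homogeneous PPP of intensity `lam`, the `N` processes are independent, and the fading is
independent of all locations. -/
structure IsIndependentScenario {Ω : Type*} [MeasurableSpace Ω] {N : ℕ}
    (X : Fin N → ℕ → Ω → Plane) (S : Fin N → ℕ → Ω → ℝ) (lam : ℝ) (μ : Measure Ω) : Prop where
  ppp : ∀ n, IsHomogeneousPPP (X n) lam μ
  indep_hops : iIndepFun (fun n => pointProcess (X n)) μ
  fading : IsRayleighFading S μ
  indep_fading : IndepFun (fun ω n i => X n i ω) (fun ω n i => S n i ω) μ

/-- Fixed eavesdropper locations: one homogeneous PPP `X 0, X 1, …` of intensity `lam` serves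
for all hops, and the fading is independent of the locations. -/
structure IsFixedScenario {Ω : Type*} [MeasurableSpace Ω] {N : ℕ}
    (X : ℕ → Ω → Plane) (S : Fin N → ℕ → Ω → ℝ) (lam : ℝ) (μ : Measure Ω) : Prop where
  ppp : IsHomogeneousPPP X lam μ
  fading : IsRayleighFading S μ
  indep_fading : IndepFun (fun ω i => X i ω) (fun ω n i => S n i ω) μ

/-- The transmitter of hop `n` (counted from `0`) in a linear network of length `L` with `N`
hops and equidistant nodes. -/
def nodePosition (N : ℕ) (L : ℝ) (n : Fin N) : Plane :=
  !₂[(n : ℝ) * (L / N), 0]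

/-- Received SNR over distance `r`, with transmit power `p`, power gain `s` and path loss
`1 / (1 + r ^ α)`. -/
def snr (p α s r : ℝ) : ℝ := p * s / (r ^ α + 1)

/-- The maximal SNR `max_e SNR_{ne}` at the eavesdroppers in hop `n`, at the outcome `ω`. -/
def maxSNR {Ω : Type*} {N : ℕ} (L p α : ℝ) (X : Fin N → ℕ → Ω → Plane)
    (S : Fin N → ℕ → Ω → ℝ) (n : Fin N) (ω : Ω) : EReal :=
  ⨆ i : ℕ, ((snr p α (S n i ω) (dist (nodePosition N L n) (X n i ω)) : ℝ) : EReal)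

/-- The SNR threshold `β_e = 2 ^ (R_t - R_s) - 1` for secrecy outage. -/
def secrecyThreshold (Rt Rs : ℝ) : ℝ := (2 : ℝ) ^ (Rt - Rs) - 1

/-- The end-to-end secrecy outage probability `P (max_n max_e SNR_{ne} > β_e)`, where `X n i` is
the location of eavesdropper `i` during hop `n`. -/
def secrecyOutageProb {Ω : Type*} [MeasurableSpace Ω] (μ : Measure Ω) {N : ℕ}
    (L p α Rt Rs : ℝ) (X : Fin N → ℕ → Ω → Plane) (S : Fin N → ℕ → Ω → ℝ) : ℝ :=
  μ.real {ω | ((secrecyThreshold Rt Rs : ℝ) : EReal) < ⨆ n : Fin N, maxSNR L p α X S n ω}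

end

/-! Given the locations, the probability of no outage is a product over hops and eavesdroppers of `1
- exp (-t)`, with `t` the gain threshold. Written as `expNeg` of a sum over points, it becomes a
Laplace functional of the Poisson process (`measure_forall_fading_le`,
`IsPoissonProcess.lintegral_expNeg`). With `g n x = exp (-t n x)`, independent hops give the
exponent `∫ ∑ n, g n`, and one common process gives `∫ (1 - ∏ n, (1 - g n))`, both against the
intensity measure. Pointwise the latter integrand is strictly smaller, by a strict union bound that
needs two hops (`one_sub_prod_one_sub_lt_sum`). The integrals are finite, so strictness survives
integration, and `expNeg` reverses it. -/

open Filter Topology ENNReal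
open scoped NNReal

/-! ### The exponential on `[0, ∞]`, where divergent sums need no separate case -/

/-- The decreasing exponential `a ↦ exp (-a)` on `[0, ∞]`. -/
noncomputable def expNeg (a : ℝ≥0∞) : ℝ≥0∞ := (EReal.exp (a : EReal))⁻¹

theorem expNeg_zero : expNeg 0 = 1 := by simp [expNeg]

theorem continuous_expNeg : Continuous expNeg :=
  (ENNReal.continuous_exp.comp continuous_coe_ennreal_ereal).inv

theorem measurable_expNeg : Measurable expNeg := continuous_expNeg.measurable

theorem expNeg_strictAnti : StrictAnti expNeg := fun a b h => by
  unfold expNeg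
  rw [ENNReal.inv_lt_inv, EReal.exp_lt_exp_iff]
  exact_mod_cast h

theorem expNeg_le_one (a : ℝ≥0∞) : expNeg a ≤ 1 :=
  expNeg_zero ▸ expNeg_strictAnti.antitone zero_le

theorem expNeg_add (a b : ℝ≥0∞) : expNeg (a + b) = expNeg a * expNeg b := by
  have h : ∀ c : ℝ≥0∞, EReal.exp (c : EReal) ≠ 0 := fun c => by simp
  unfold expNeg
  rw [EReal.coe_ennreal_add, EReal.exp_add, ENNReal.mul_inv (Or.inl (h a)) (Or.inr (h b))]

theorem expNeg_sum {ι : Type*} (s : Finset ι) (a : ι → ℝ≥0∞) :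
    expNeg (∑ i ∈ s, a i) = ∏ i ∈ s, expNeg (a i) := by
  classical
  induction s using Finset.induction_on with
  | empty => simp [expNeg_zero]
  | insert i s hi ih => rw [Finset.sum_insert hi, Finset.prod_insert hi, expNeg_add, ih]

theorem expNeg_mul_natCast (a : ℝ≥0∞) (k : ℕ) : expNeg (a * k) = expNeg a ^ k := by
  induction k with
  | zero => simp [expNeg_zero]
  | succ k ih => rw [Nat.cast_succ, mul_add, mul_one, expNeg_add, ih, pow_succ]

theorem expNeg_ofReal {x : ℝ} (hx : 0 ≤ x) :
    expNeg (ENNReal.ofReal x) = ENNReal.ofReal (Real.exp (-x)) := by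
  unfold expNeg
  rw [EReal.coe_ennreal_ofReal, max_eq_left hx, EReal.exp_coe, Real.exp_neg,
    ENNReal.ofReal_inv_of_pos (Real.exp_pos x)]

/-- Probability generating function of the Poisson law, summed from the exponential series. -/
theorem lintegral_poissonMeasure_pow (r : ℝ≥0) {q : ℝ≥0∞} (hq : q ≤ 1) :
    ∫⁻ k, q ^ k ∂(poissonMeasure r) = expNeg (r * (1 - q)) := by
  lift q to ℝ≥0 using ne_top_of_le_ne_top one_ne_top hq
  have hq' : (q : ℝ) ≤ 1 := by exact_mod_cast hq
  have hs : HasSum (fun k : ℕ => Real.exp (-r) * (r : ℝ) ^ k / k.factorial * (q : ℝ) ^ k)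
      (Real.exp (-(r * (1 - q)))) := by
    convert! (NormedSpace.expSeries_div_hasSum_exp ((r * q : ℝ))).mul_left (Real.exp (-r)) using 1
    · ext k; rw [mul_pow]; ring
    · rw [← Real.exp_eq_exp_ℝ, ← Real.exp_add]; congr 1; ring
  have h1 : (r : ℝ≥0∞) * (1 - q) = ENNReal.ofReal (r * (1 - q)) := by
    rw [ENNReal.ofReal_mul r.coe_nonneg, ENNReal.ofReal_sub _ q.coe_nonneg]; simp
  rw [h1, expNeg_ofReal (mul_nonneg r.coe_nonneg (by linarith)), ← hs.tsum_eq,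
    ENNReal.ofReal_tsum_of_nonneg (fun k => by positivity) hs.summable, poissonMeasure,
    lintegral_sum_measure]
  congr 1; ext k
  rw [lintegral_smul_measure, lintegral_dirac, smul_eq_mul,
    ENNReal.ofReal_mul (p := Real.exp (-r) * (r : ℝ) ^ k / k.factorial) (by positivity),
    ENNReal.ofReal_pow q.coe_nonneg, ENNReal.ofReal_coe_nnreal]

/-! ### Laplace functional of a Poisson process -/

section Laplace

variable {Ω E : Type*} [MeasurableSpace Ω] [MeasurableSpace E] {Φ : Ω → Measure E}
  {Λ : Measure E} {μ : Measure Ω}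

theorem IsPoissonProcess.lintegral_expNeg_mul [IsProbabilityMeasure μ]
    (h : IsPoissonProcess Φ Λ μ) {B : Set E} (hB : MeasurableSet B) {a : ℝ≥0∞}
    (ha : a = 0 ∨ Λ B < ⊤) :
    ∫⁻ ω, expNeg (a * Φ ω B) ∂μ = expNeg ((1 - expNeg a) * Λ B) := by
  rcases ha with rfl | ha
  · simp [expNeg_zero]
  · have hm : Measurable fun x : ℝ≥0∞ => expNeg (a * x) :=
      measurable_expNeg.comp (measurable_const.mul measurable_id)
    rw [(h.law B hB ha).lintegral_comp hm.aemeasurable,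
      lintegral_map hm Measurable.of_discrete]
    simp_rw [expNeg_mul_natCast]
    rw [lintegral_poissonMeasure_pow _ (expNeg_le_one a), ENNReal.coe_toNNReal ha.ne, mul_comm]

theorem IsPoissonProcess.iIndepFun_apply (h : IsPoissonProcess Φ Λ μ) {ι : Type*} [Fintype ι]
    {B : ι → Set E} (hB : ∀ j, MeasurableSet (B j))
    (hd : Pairwise fun i j => Disjoint (B i) (B j)) :
    iIndepFun (fun j ω => Φ ω (B j)) μ := by
  let e := Fintype.equivFin ι
  have h1 := (h.indep _ (fun j => B (e.symm j)) (fun j => hB _)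
    (fun i j hij => hd (e.symm.injective.ne hij))).precomp e.injective
  simpa using h1

/-- The fibres of `f` are disjoint, so their counts are independent and the expectation factors. The
zero fibre is exempt from finiteness because it contributes nothing, even with infinite intensity.
-/
theorem IsPoissonProcess.lintegral_expNeg_simpleFunc [IsProbabilityMeasure μ]
    (h : IsPoissonProcess Φ Λ μ) (f : SimpleFunc E ℝ≥0∞)
    (hf : ∀ a ∈ f.range, a ≠ 0 → Λ (f ⁻¹' {a}) < ⊤) :
    ∫⁻ ω, expNeg (∫⁻ x, f x ∂(Φ ω)) ∂μ = expNeg (∫⁻ x, (1 - expNeg (f x)) ∂Λ) := by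
  have hR : ∫⁻ x, (1 - expNeg (f x)) ∂Λ = ∑ a ∈ f.range, (1 - expNeg a) * Λ (f ⁻¹' {a}) := by
    rw [← SimpleFunc.map_lintegral (fun a => 1 - expNeg a) f, ← SimpleFunc.lintegral_eq_lintegral]
    rfl
  have hind := h.iIndepFun_apply (ι := f.range) (B := fun a => f ⁻¹' {(a : ℝ≥0∞)})
    (fun a => f.measurableSet_fiber a) (fun a b hab => by
      refine Disjoint.preimage _ ?_
      simpa using fun h => hab (Subtype.ext h))
  have hm : ∀ a : ℝ≥0∞, Measurable fun x : ℝ≥0∞ => expNeg (a * x) := fun a =>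
    measurable_expNeg.comp (measurable_const.mul measurable_id)
  have hL : ∀ ω, expNeg (∫⁻ x, f x ∂(Φ ω)) =
      ∏ a : f.range, expNeg (a * Φ ω (f ⁻¹' {(a : ℝ≥0∞)})) := fun ω => by
    rw [SimpleFunc.lintegral_eq_lintegral, SimpleFunc.lintegral, expNeg_sum,
      ← Finset.prod_coe_sort f.range]
  simp_rw [hL]
  rw [lintegral_prod_eq_prod_lintegral_of_indepFun _
      (fun (a : f.range) ω => expNeg (a * Φ ω (f ⁻¹' {(a : ℝ≥0∞)})))
      (hind.comp _ fun a => hm a)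
      (fun a => (hm a).comp ((Measure.measurable_coe (f.measurableSet_fiber a)).comp h.measurable)),
    hR, expNeg_sum, ← Finset.prod_coe_sort f.range]
  refine Finset.prod_congr rfl fun a _ => h.lintegral_expNeg_mul (f.measurableSet_fiber a) ?_
  by_cases ha : (a : ℝ≥0∞) = 0
  · exact Or.inl ha
  · exact Or.inr (hf a a.2 ha)

/-- The Laplace functional of a Poisson process. -/
theorem IsPoissonProcess.lintegral_expNeg [IsProbabilityMeasure μ] [SigmaFinite Λ]
    (h : IsPoissonProcess Φ Λ μ) {f : E → ℝ≥0∞} (hf : Measurable f) :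
    ∫⁻ ω, expNeg (∫⁻ x, f x ∂(Φ ω)) ∂μ = expNeg (∫⁻ x, (1 - expNeg (f x)) ∂Λ) := by
  -- Cutting off to the spanning sets makes every nonzero fibre have finite intensity while keeping
  -- monotone convergence to `f`.
  let g : ℕ → SimpleFunc E ℝ≥0∞ := fun n => (SimpleFunc.eapprox f n).restrict (spanningSets Λ n)
  have hg : ∀ n x, g n x = (spanningSets Λ n).indicator (SimpleFunc.eapprox f n) x := fun n x => by
    rw [SimpleFunc.restrict_apply _ (measurableSet_spanningSets Λ n)]
  have hmono : ∀ x, Monotone fun n => g n x := fun x m n hmn => by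
    simp only [hg]
    by_cases hx : x ∈ spanningSets Λ m
    · rw [Set.indicator_of_mem hx, Set.indicator_of_mem (monotone_spanningSets Λ hmn hx)]
      exact SimpleFunc.monotone_eapprox f hmn x
    · rw [Set.indicator_of_notMem hx]; exact zero_le
  have hlim : ∀ x, Tendsto (fun n => g n x) atTop (𝓝 (f x)) := fun x => by
    refine (SimpleFunc.tendsto_eapprox hf x).congr' ?_
    filter_upwards [eventually_ge_atTop (spanningSetsIndex Λ x)] with n hn
    rw [hg, Set.indicator_of_mem (mem_spanningSets_of_index_le Λ x hn)]
  have hint : ∀ ν : Measure E, Tendsto (fun n => ∫⁻ x, g n x ∂ν) atTop (𝓝 (∫⁻ x, f x ∂ν)) :=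
    fun ν => lintegral_tendsto_of_tendsto_of_monotone (fun n => (g n).measurable.aemeasurable)
      (ae_of_all _ hmono) (ae_of_all _ hlim)
  have hm' : Measurable fun a => 1 - expNeg a := measurable_const.sub measurable_expNeg
  have hR : Tendsto (fun n => ∫⁻ x, (1 - expNeg (g n x)) ∂Λ) atTop
      (𝓝 (∫⁻ x, (1 - expNeg (f x)) ∂Λ)) :=
    lintegral_tendsto_of_tendsto_of_monotone
      (fun n => (hm'.comp (g n).measurable).aemeasurable)
      (ae_of_all _ fun x m n hmn =>
        tsub_le_tsub_left (expNeg_strictAnti.antitone (hmono x hmn)) 1)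
      (ae_of_all _ fun x => ENNReal.Tendsto.sub tendsto_const_nhds
        ((continuous_expNeg.tendsto _).comp (hlim x)) (Or.inl one_ne_top))
  -- These integrands decrease in `n`, hence dominated convergence with bound `1`.
  have hL : Tendsto (fun n => ∫⁻ ω, expNeg (∫⁻ x, g n x ∂(Φ ω)) ∂μ) atTop
      (𝓝 (∫⁻ ω, expNeg (∫⁻ x, f x ∂(Φ ω)) ∂μ)) := by
    refine tendsto_lintegral_of_dominated_convergence (fun _ => 1)
      (fun n => measurable_expNeg.comp
        ((Measure.measurable_lintegral (g n).measurable).comp h.measurable))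
      (fun n => ae_of_all _ fun ω => expNeg_le_one _) (by simp)
      (ae_of_all _ fun ω => (continuous_expNeg.tendsto _).comp (hint (Φ ω)))
  refine tendsto_nhds_unique hL ?_
  refine ((continuous_expNeg.tendsto _).comp hR).congr fun n => ?_
  refine (h.lintegral_expNeg_simpleFunc (g n) fun a _ ha => ?_).symm
  refine (measure_mono fun x hx => ?_).trans_lt (measure_spanningSets_lt_top Λ n)
  by_contra hx'
  rw [Set.mem_preimage, hg, Set.indicator_of_notMem hx'] at hx
  exact ha hx.symm

end Laplace

theorem lintegral_pointProcess {Ω : Type*} (X : ℕ → Ω → Plane) (ω : Ω) (f : Plane → ℝ≥0∞) :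
    ∫⁻ x, f x ∂(pointProcess X ω) = ∑' i, f (X i ω) := by
  simp_rw [pointProcess, lintegral_sum_measure, lintegral_dirac]

/-! ### Averaging over the fading gains -/

section Fading

variable {Ω : Type*} [MeasurableSpace Ω] {μ : Measure Ω}

/-- Minus the logarithm of the probability that a unit mean exponential variable is at most `t`. -/
noncomputable def negLogExpCDF (t : ℝ) : ℝ≥0∞ := ENNReal.ofReal (-Real.log (1 - Real.exp (-t)))

theorem measurable_negLogExpCDF : Measurable negLogExpCDF := by
  unfold negLogExpCDF; fun_prop

theorem expNeg_negLogExpCDF {t : ℝ} (ht : 0 < t) :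
    expNeg (negLogExpCDF t) = ENNReal.ofReal (1 - Real.exp (-t)) := by
  have h1 : Real.exp (-t) < 1 := by simpa using ht
  have h2 : 0 < 1 - Real.exp (-t) := by linarith
  have h3 : Real.log (1 - Real.exp (-t)) ≤ 0 :=
    Real.log_nonpos h2.le (by linarith [Real.exp_pos (-t)])
  rw [negLogExpCDF, expNeg_ofReal (by linarith), neg_neg, Real.exp_log h2]

theorem one_sub_expNeg_negLogExpCDF {t : ℝ} (ht : 0 < t) :
    1 - expNeg (negLogExpCDF t) = ENNReal.ofReal (Real.exp (-t)) := by
  have h1 : Real.exp (-t) < 1 := by simpa using ht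
  rw [expNeg_negLogExpCDF ht, ← ENNReal.ofReal_one, ← ENNReal.ofReal_sub _ (by linarith)]
  congr 1; ring

theorem measure_le_of_hasLaw_exp {S : Ω → ℝ} (h : HasLaw S (expMeasure 1) μ) {t : ℝ}
    (ht : 0 < t) : μ {ω | S ω ≤ t} = expNeg (negLogExpCDF t) := by
  have := isProbabilityMeasure_expMeasure one_pos
  rw [h.measure_eq (p := fun s => s ≤ t) measurableSet_Iic, expNeg_negLogExpCDF ht]
  change expMeasure 1 (Set.Iic t) = _
  rw [← ofReal_cdf, cdf_expMeasure_eq one_pos, if_pos ht.le, one_mul]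

/-- Independence gives finite products; continuity from above along finite sets passes to all
indices. -/
theorem measure_forall_le_of_iIndepFun_exp [IsProbabilityMeasure μ] {ι : Type*} [Countable ι]
    {S : ι → Ω → ℝ} (hm : ∀ q, Measurable (S q)) (hl : ∀ q, HasLaw (S q) (expMeasure 1) μ)
    (hi : iIndepFun S μ) {t : ι → ℝ} (ht : ∀ q, 0 < t q) :
    μ {ω | ∀ q, S q ω ≤ t q} = expNeg (∑' q, negLogExpCDF (t q)) := by
  have hmeas : ∀ q, MeasurableSet {ω | S q ω ≤ t q} := fun q => hm q measurableSet_Iic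
  have h1 : Tendsto (fun s : Finset ι => μ (⋂ q ∈ s, {ω | S q ω ≤ t q})) atTop
      (𝓝 (μ (⋂ s : Finset ι, ⋂ q ∈ s, {ω | S q ω ≤ t q}))) :=
    tendsto_measure_iInter_atTop
      (fun s => (s.measurableSet_biInter fun q _ => hmeas q).nullMeasurableSet)
      (fun s s' hs => Set.biInter_subset_biInter_left hs) ⟨∅, measure_ne_top _ _⟩
  have h2 : Tendsto (fun s : Finset ι => expNeg (∑ q ∈ s, negLogExpCDF (t q))) atTop
      (𝓝 (expNeg (∑' q, negLogExpCDF (t q)))) :=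
    (continuous_expNeg.tendsto _).comp ENNReal.summable.hasSum
  have h3 : (⋂ s : Finset ι, ⋂ q ∈ s, {ω | S q ω ≤ t q}) = {ω | ∀ q, S q ω ≤ t q} := by
    ext ω
    simp only [Set.mem_iInter, Set.mem_ofPred_eq]
    exact ⟨fun h q => h {q} q (Finset.mem_singleton_self q), fun h _ q _ => h q⟩
  rw [← h3]
  refine tendsto_nhds_unique h1 (h2.congr fun s => ?_)
  rw [hi.meas_biInter (S := s) (s := fun q => {ω | S q ω ≤ t q})
    (fun q _ => ⟨Set.Iic (t q), measurableSet_Iic, rfl⟩), expNeg_sum]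
  exact Finset.prod_congr rfl fun q _ => (measure_le_of_hasLaw_exp (hl q) (ht q)).symm

/-- Fubini for the product of the laws of locations and gains: freeze the locations, then integrate
out the gains. Nothing is assumed about how the locations of different hops are related, so both
scenarios are covered. -/
theorem measure_forall_fading_le [IsProbabilityMeasure μ] {N : ℕ} {X : Fin N → ℕ → Ω → Plane}
    {S : Fin N → ℕ → Ω → ℝ} (hX : ∀ n i, Measurable (X n i)) (hS : IsRayleighFading S μ)
    (hXS : IndepFun (fun ω n i => X n i ω) (fun ω n i => S n i ω) μ)
    {t : Fin N → Plane → ℝ} (htm : ∀ n, Measurable (t n)) (ht : ∀ n x, 0 < t n x) :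
    μ {ω | ∀ n i, S n i ω ≤ t n (X n i ω)} =
      ∫⁻ ω, expNeg (∑ n, ∫⁻ x, negLogExpCDF (t n x) ∂(pointProcess (X n) ω)) ∂μ := by
  set U : Ω → Fin N → ℕ → Plane := fun ω n i => X n i ω
  set V : Ω → Fin N → ℕ → ℝ := fun ω n i => S n i ω
  have hU : Measurable U := by
    refine measurable_pi_lambda _ fun n => measurable_pi_lambda _ fun i => hX n i
  have hV : Measurable V := by
    refine measurable_pi_lambda _ fun n => measurable_pi_lambda _ fun i => hS.measurable n i
  let A : Set ((Fin N → ℕ → Plane) × (Fin N → ℕ → ℝ)) := {z | ∀ n i, z.2 n i ≤ t n (z.1 n i)}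
  have hA : MeasurableSet A := by
    have : A = ⋂ n, ⋂ i, {z | z.2 n i ≤ t n (z.1 n i)} := by ext; simp [A]
    rw [this]
    refine MeasurableSet.iInter fun n => MeasurableSet.iInter fun i => measurableSet_le ?_ ?_
    · fun_prop
    · exact (htm n).comp (by fun_prop)
  have h1 : μ {ω | ∀ n i, S n i ω ≤ t n (X n i ω)} = (μ.map fun ω => (U ω, V ω)) A := by
    rw [Measure.map_apply (hU.prodMk hV) hA]; rfl
  rw [h1, hXS.map_prod_eq_prod_map_map hU.aemeasurable hV.aemeasurable, Measure.prod_apply hA,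
    lintegral_map (measurable_measure_prodMk_left hA) hU]
  refine lintegral_congr fun ω => ?_
  rw [Measure.map_apply hV (measurable_prodMk_left hA)]
  have h2 := measure_forall_le_of_iIndepFun_exp (S := fun q : Fin N × ℕ => S q.1 q.2)
    (fun q => hS.measurable _ _) (fun q => hS.law _ _) hS.indep
    (t := fun q => t q.1 (X q.1 q.2 ω)) (fun q => ht _ _)
  rw [ENNReal.tsum_prod (f := fun n i => negLogExpCDF (t n (X n i ω))), tsum_fintype] at h2
  simp_rw [lintegral_pointProcess]
  rw [← h2]
  congr 1
  ext ω'
  simp [A, U, V, Prod.forall]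

end Fading

/-! ### The strict union bound and integrability over the plane -/

theorem one_sub_sum_le_prod_one_sub {ι : Type*} (s : Finset ι) {g : ι → ℝ}
    (h0 : ∀ i, 0 ≤ g i) (h1 : ∀ i, g i ≤ 1) : 1 - ∑ i ∈ s, g i ≤ ∏ i ∈ s, (1 - g i) := by
  classical
  induction s using Finset.induction_on with
  | empty => simp
  | insert i s hi ih =>
    rw [Finset.sum_insert hi, Finset.prod_insert hi]
    have hP : ∏ i ∈ s, (1 - g i) ≤ 1 :=
      Finset.prod_le_one (fun j _ => by linarith [h1 j]) (fun j _ => by linarith [h0 j])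
    nlinarith [h0 i, mul_le_mul_of_nonneg_left hP (h0 i)]

theorem one_sub_prod_one_sub_lt_sum {N : ℕ} (hN : 2 ≤ N) {g : Fin N → ℝ}
    (h0 : ∀ i, 0 < g i) (h1 : ∀ i, g i ≤ 1) : 1 - ∏ i, (1 - g i) < ∑ i, g i := by
  obtain ⟨m, rfl⟩ := Nat.exists_eq_add_of_le' hN
  have h := one_sub_sum_le_prod_one_sub (Finset.univ : Finset (Fin (m + 1)))
    (g := fun i => g i.succ) (fun i => (h0 _).le) (fun i => h1 _)
  rw [Fin.sum_univ_succ, Fin.prod_univ_succ]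
  -- Strictness comes from here: the product over the remaining indices is nonempty, so multiplying
  -- it by `g 0 > 0` loses something.
  have hP : ∏ i : Fin (m + 1), (1 - g i.succ) < 1 := by
    rw [Fin.prod_univ_succ]
    have : ∏ i : Fin m, (1 - g i.succ.succ) ≤ 1 :=
      Finset.prod_le_one (fun j _ => by linarith [h1 j.succ.succ])
        (fun j _ => by linarith [h0 j.succ.succ])
    nlinarith [h0 (Fin.succ 0), h1 (Fin.succ 0)]
  nlinarith [h0 0, mul_lt_mul_of_pos_left hP (h0 0)]

theorem integrable_exp_neg_dist_rpow {α c : ℝ} (hα : 0 < α) (hc : 0 < c) (a : Plane) :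
    Integrable (fun x : Plane => Real.exp (-(c * (dist a x ^ α + 1)))) volume := by
  have h : Integrable (fun x : Plane => Real.exp (-c * ‖x‖ ^ α)) volume := by
    rw [integrable_fun_norm_addHaar volume (f := fun r : ℝ => Real.exp (-c * r ^ α))]
    have := integrableOn_rpow_mul_exp_neg_mul_rpow (s := 1) (by norm_num) hα hc
    simpa using this
  have h2 := ((h.comp_sub_right a).mul_const (Real.exp (-c)))
  refine h2.congr (ae_of_all _ fun x => ?_)
  simp only
  rw [← Real.exp_add, dist_comm, dist_eq_norm]
  congr 1; ring

/-! ### No-outage probabilities in the two scenarios -/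

section Network

theorem sigmaFinite_ofReal_smul {E : Type*} [MeasurableSpace E] (ν : Measure E) [SigmaFinite ν]
    (c : ℝ) : SigmaFinite (ENNReal.ofReal c • ν) :=
  inferInstanceAs (SigmaFinite (c.toNNReal • ν))

/-- The fading gain above which an eavesdropper at `x` has an SNR above the threshold in hop `n`. -/
noncomputable def gainThreshold {N : ℕ} (L p α Rt Rs : ℝ) (n : Fin N) (x : Plane) : ℝ :=
  secrecyThreshold Rt Rs / p * (dist (nodePosition N L n) x ^ α + 1)

variable {N : ℕ} {L p α Rt Rs : ℝ}

theorem secrecyThreshold_pos (hR : Rs < Rt) : 0 < secrecyThreshold Rt Rs := by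
  have := Real.one_lt_rpow (x := 2) (z := Rt - Rs) (by norm_num) (by linarith)
  unfold secrecyThreshold; linarith

theorem gainThreshold_pos (hp : 0 < p) (hR : Rs < Rt) (n : Fin N) (x : Plane) :
    0 < gainThreshold L p α Rt Rs n x := by
  have := secrecyThreshold_pos hR
  unfold gainThreshold; positivity

theorem measurable_gainThreshold (n : Fin N) : Measurable (gainThreshold L p α Rt Rs n) := by
  unfold gainThreshold; fun_prop

theorem snr_le_iff (hp : 0 < p) (n : Fin N) (x : Plane) (s : ℝ) :
    snr p α s (dist (nodePosition N L n) x) ≤ secrecyThreshold Rt Rs ↔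
      s ≤ gainThreshold L p α Rt Rs n x := by
  have hr : 0 < dist (nodePosition N L n) x ^ α + 1 := by positivity
  rw [snr, gainThreshold, div_le_iff₀ hr, div_mul_eq_mul_div, le_div_iff₀ hp, mul_comm p s]

theorem secrecyOutageProb_eq {Ω : Type*} [MeasurableSpace Ω] {μ : Measure Ω}
    [IsProbabilityMeasure μ] (hp : 0 < p) {X : Fin N → ℕ → Ω → Plane} {S : Fin N → ℕ → Ω → ℝ}
    (hX : ∀ n i, Measurable (X n i)) (hS : ∀ n i, Measurable (S n i)) :
    secrecyOutageProb μ L p α Rt Rs X S =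
      1 - μ.real {ω | ∀ n i, S n i ω ≤ gainThreshold L p α Rt Rs n (X n i ω)} := by
  have hm : MeasurableSet {ω | ∀ n i, S n i ω ≤ gainThreshold L p α Rt Rs n (X n i ω)} := by
    have : {ω | ∀ n i, S n i ω ≤ gainThreshold L p α Rt Rs n (X n i ω)} =
        ⋂ n, ⋂ i, {ω | S n i ω ≤ gainThreshold L p α Rt Rs n (X n i ω)} := by ext; simp
    rw [this]
    exact MeasurableSet.iInter fun n => MeasurableSet.iInter fun i =>
      measurableSet_le (hS n i) ((measurable_gainThreshold n).comp (hX n i))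
  rw [← probReal_compl_eq_one_sub hm, secrecyOutageProb]
  congr 1
  ext ω
  rw [Set.mem_compl_iff, Set.mem_ofPred_eq, Set.mem_ofPred_eq, ← not_le, not_iff_not]
  simp only [maxSNR, iSup_le_iff, EReal.coe_le_coe_iff, snr_le_iff hp]

variable {lam : ℝ} {Ω : Type*} [MeasurableSpace Ω] {μ : Measure Ω} [IsProbabilityMeasure μ]

theorem IsIndependentScenario.measure_noOutage (hp : 0 < p) (hR : Rs < Rt)
    {X : Fin N → ℕ → Ω → Plane} {S : Fin N → ℕ → Ω → ℝ} (h : IsIndependentScenario X S lam μ) :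
    μ {ω | ∀ n i, S n i ω ≤ gainThreshold L p α Rt Rs n (X n i ω)} =
      expNeg (∫⁻ x, ∑ n, ENNReal.ofReal (Real.exp (-gainThreshold (N := N) L p α Rt Rs n x))
        ∂(ENNReal.ofReal lam • (volume : Measure Plane))) := by
  have := sigmaFinite_ofReal_smul (volume : Measure Plane) lam
  have hf : ∀ n : Fin N, Measurable fun x => negLogExpCDF (gainThreshold L p α Rt Rs n x) :=
    fun n => measurable_negLogExpCDF.comp (measurable_gainThreshold n)
  have hF : ∀ n : Fin N, Measurable fun Φ : Measure Plane =>
      expNeg (∫⁻ x, negLogExpCDF (gainThreshold L p α Rt Rs n x) ∂Φ) := fun n =>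
    measurable_expNeg.comp (Measure.measurable_lintegral (hf n))
  rw [measure_forall_fading_le (fun n => (h.ppp n).1) h.fading h.indep_fading
    measurable_gainThreshold (gainThreshold_pos hp hR)]
  -- One factor per hop, so that independence of the processes splits the expectation.
  simp_rw [expNeg_sum]
  rw [lintegral_prod_eq_prod_lintegral_of_indepFun _
      (fun n ω => expNeg (∫⁻ x, negLogExpCDF (gainThreshold L p α Rt Rs n x)
        ∂(pointProcess (X n) ω))) (h.indep_hops.comp _ hF)
    (fun n => (hF n).comp (h.ppp n).2.measurable),
    lintegral_finsetSum _ (fun n _ => by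
      have := measurable_gainThreshold (L := L) (p := p) (α := α) (Rt := Rt) (Rs := Rs) n
      fun_prop), expNeg_sum]
  refine Finset.prod_congr rfl fun n _ => ((h.ppp n).2.lintegral_expNeg (hf n)).trans ?_
  simp_rw [one_sub_expNeg_negLogExpCDF (gainThreshold_pos hp hR _ _)]

theorem IsFixedScenario.measure_noOutage (hp : 0 < p) (hR : Rs < Rt)
    {X : ℕ → Ω → Plane} {S : Fin N → ℕ → Ω → ℝ} (h : IsFixedScenario X S lam μ) :
    μ {ω | ∀ n i, S n i ω ≤ gainThreshold L p α Rt Rs n (X i ω)} =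
      expNeg (∫⁻ x, ENNReal.ofReal (1 - ∏ n : Fin N, (1 - Real.exp (-gainThreshold L p α Rt Rs n x)))
        ∂(ENNReal.ofReal lam • (volume : Measure Plane))) := by
  have := sigmaFinite_ofReal_smul (volume : Measure Plane) lam
  have hf : ∀ n : Fin N, Measurable fun x => negLogExpCDF (gainThreshold L p α Rt Rs n x) :=
    fun n => measurable_negLogExpCDF.comp (measurable_gainThreshold n)
  have hXS : IndepFun (fun ω (_ : Fin N) i => X i ω) (fun ω n i => S n i ω) μ :=
    h.indep_fading.comp (φ := fun (u : ℕ → Plane) (_ : Fin N) => u) (ψ := id)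
      (by fun_prop) measurable_id
  rw [measure_forall_fading_le (X := fun _ => X) (fun _ => h.ppp.1) h.fading hXS
    measurable_gainThreshold (gainThreshold_pos hp hR)]
  -- All hops see the same points, so the sum over hops moves inside a single Laplace functional.
  simp_rw [← lintegral_finsetSum _ fun n _ => hf n]
  rw [h.ppp.2.lintegral_expNeg (Finset.measurable_fun_sum _ fun n _ => hf n)]
  congr 1
  refine lintegral_congr fun x => ?_
  have h1 : ∀ n : Fin N, 0 ≤ 1 - Real.exp (-gainThreshold L p α Rt Rs n x) := fun n => by
    simpa using (gainThreshold_pos hp hR n x).le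
  simp_rw [expNeg_sum, expNeg_negLogExpCDF (gainThreshold_pos hp hR _ _)]
  rw [← ENNReal.ofReal_prod_of_nonneg fun n _ => h1 n, ← ENNReal.ofReal_one,
    ← ENNReal.ofReal_sub _ (Finset.prod_nonneg fun n _ => h1 n)]

end Network

theorem corollary1
    (N : ℕ) (hN : 2 ≤ N) (L p α lam Rt Rs : ℝ)
    (hL : 0 < L) (hp : 0 < p) (hα : 0 < α) (hlam : 0 < lam) (hR : Rs < Rt)
    {Ω : Type*} [MeasurableSpace Ω] (P : Measure Ω) [IsProbabilityMeasure P]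
    (X : Fin N → ℕ → Ω → Plane) (S : Fin N → ℕ → Ω → ℝ)
    (hind : IsIndependentScenario X S lam P)
    {Ω' : Type*} [MeasurableSpace Ω'] (P' : Measure Ω') [IsProbabilityMeasure P']
    (X' : ℕ → Ω' → Plane) (S' : Fin N → ℕ → Ω' → ℝ)
    (hfix : IsFixedScenario X' S' lam P') :
    secrecyOutageProb P' L p α Rt Rs (fun _ : Fin N => X') S' <
      secrecyOutageProb P L p α Rt Rs X S := by
  rw [secrecyOutageProb_eq hp (fun _ => hfix.ppp.1) hfix.fading.measurable,
    secrecyOutageProb_eq hp (fun n => (hind.ppp n).1) hind.fading.measurable]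
  refine sub_lt_sub_left ((ENNReal.toReal_lt_toReal (measure_ne_top _ _)
    (measure_ne_top _ _)).2 ?_) 1
  rw [hind.measure_noOutage hp hR, hfix.measure_noOutage hp hR]
  apply expNeg_strictAnti
  let g : Fin N → Plane → ℝ := fun n x => Real.exp (-gainThreshold L p α Rt Rs n x)
  have hg0 : ∀ n x, 0 < g n x := fun n x => Real.exp_pos _
  have hg1 : ∀ n x, g n x ≤ 1 := fun n x => by
    simpa [g] using (gainThreshold_pos hp hR n x).le
  have hgm : ∀ n, Measurable (g n) := fun n =>
    Real.measurable_exp.comp (measurable_gainThreshold n).neg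
  have hsum : ∀ x, ∑ n, ENNReal.ofReal (g n x) = ENNReal.ofReal (∑ n, g n x) := fun x =>
    (ENNReal.ofReal_sum_of_nonneg fun n _ => (hg0 n x).le).symm
  have hlt : ∀ x, ENNReal.ofReal (1 - ∏ n, (1 - g n x)) < ∑ n, ENNReal.ofReal (g n x) := fun x => by
    have h := one_sub_prod_one_sub_lt_sum hN (fun n => hg0 n x) (fun n => hg1 n x)
    rw [hsum]
    refine (ENNReal.ofReal_lt_ofReal_iff (lt_of_le_of_lt ?_ h)).2 h
    exact sub_nonneg.2 (Finset.prod_le_one (fun n _ => sub_nonneg.2 (hg1 n x))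
      fun n _ => sub_le_self _ (hg0 n x).le)
  -- Without finiteness both exponents could be `⊤` and the strict inequality would be lost.
  have hfin : ∫⁻ x, ∑ n, ENNReal.ofReal (g n x)
      ∂(ENNReal.ofReal lam • (volume : Measure Plane)) < ⊤ := by
    rw [lintegral_smul_measure, lintegral_finsetSum _ fun n _ => (hgm n).ennreal_ofReal]
    refine ENNReal.mul_lt_top ENNReal.ofReal_lt_top (ENNReal.sum_lt_top.2 fun n _ => ?_)
    exact (integrable_exp_neg_dist_rpow hα (div_pos (secrecyThreshold_pos hR) hp)
      (nodePosition N L n)).lintegral_lt_top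
  have hle := lintegral_mono (μ := ENNReal.ofReal lam • (volume : Measure Plane))
    fun x => (hlt x).le
  refine lintegral_strict_mono ?_ ?_ (hle.trans_lt hfin).ne (ae_of_all _ hlt)
  · simp [hlam, NeZero.ne]
  · exact (Finset.measurable_fun_sum _ fun n _ => (hgm n).ennreal_ofReal).aemeasurable
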